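/- Let $G$ be a compact, connected Lie group with Lie algebra $\mathfrak g$, and identify $\mathfrak g^*\cong\mathfrak g$ by a fixed $\mathrm{Ad}$-invariant inner product $\langle\cdot,\cdot\rangle$. For a smooth $G$-manifold $W$ (possibly with boundary), $\xi\in\mathfrak g$ and a map $\phi:W\to\mathfrak g$, let $$\xi^W(w)=\tfrac{d}{dt}\big|_{t=0}\exp(-t\xi)\cdot w,\qquad X^\phi(w)=\tfrac{d}{dt}\big|_{t=0}\exp(-t\phi(w))\cdot w .$$ The map $\phi$ is called *taming* (over an invariant open set $S \subseteq W$) if the set of zeroes of $X^\phi$ (in $S$) is compact. Let $(M,\omega)$ be a Hamiltonian $G$-space with equivariant moment map $\mu^E:M\to\mathfrak g$, and let $E\to M$ be a pre-quantum line bundle: a $G$-equivariant Hermitian line bundle with a $G$-invariant Hermitian connection $\nabla^E$ such that $\frac{\sqrt{-1}}{2\pi}(\nabla^E)^2=\omega$ and such that the Kostant formula $$2\pi\sqrt{-1}\,\langle\mu^E,\xi\rangle=\nabla^E_{\xi^M}-\mathcal L^E_\xi\qquad(\xi\in\mathfrak g)$$ holds, where $\mathcal L^E_\xi$ is the Lie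 derivative of sections of $E$. Let $J$ be a $G$-invariant almost complex structure on $M$ such that $g(X,Y)=\omega(X,JY)$ is a Riemannian metric. Let $N$ be a compact Hamiltonian $G$-space with pre-quantum line bundle $F$ and moment map $\mu^F:N\to\mathfrak g$, in the same sense. Let $U\subseteq M$ be a $G$-invariant, open, relatively compact subset such that $\mu^E$ is taming over $U$, and let $V$ be a $G$-invariant, relatively compact neighbourhood of $\{X^{\mu^E}=0\}\cap U$ with $\overline V\subset U$. Let $\chi$ be a smooth $G$-invariant real function on $U$, and let $\mu^E_\chi:U\to\mathfrak g$ be the map determined through the Kostant formula by the connection $\nabla^E+2\pi\sqrt{-1}\,\chi\cdot g(X^{\mu^E},\cdot)$ on $E|_U$. Suppose that $\chi$ is chosen so that (1) $\mu^E_\chi$ is proper; (2) $\mu^E_\chi|_V=\mu^E|_V$; (3) $\|\mu^E_\chi\|\ge\|\mu^E|_U\|$; (4) $X^{\mu^E}|_U$ and $X^{\mu^E_\chi}$ have the same zeroes. Let $\eta\in C^\infty(\mathbb R)$ have values in $[0,1]$, with $\eta(t)=0$ for $t\le 1/3$ and $\eta(t)=1$ for $t\ge 2/3$. Let $G$ act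 on $U\times N\times[0,1]$ diagonally on the first two factors and trivially on the third. Then the map $$\phi:U\times N\times[0,1]\to\mathfrak g,\qquad \phi(m,n,t)=\mu^E_\chi(m)+\eta(t)\,\mu^F(n),$$ is taming, i.e. the set of zeroes of $X^\phi$ in $U\times N\times[0,1]$ is compact. -/

import Mathlib

open Set Bundle
open scoped Manifold ContDiff Topology

noncomputable section

namespace PreQuant

/-! ### Lie group actions -/

section Actions

variable {EG : Type*} [NormedAddCommGroup EG] [NormedSpace ℝ EG]
  {G : Type*} [TopologicalSpace G] [ChartedSpace EG G] [Group G]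

/-- The Lie algebra of `G`, the tangent space at the identity. -/
abbrev LieAlg (EG : Type*) [NormedAddCommGroup EG] [NormedSpace ℝ EG]
    (G : Type*) [TopologicalSpace G] [ChartedSpace EG G] [Group G] : Type _ :=
  GroupLieAlgebra 𝓘(ℝ, EG) G

/-- The adjoint action of `g` on the Lie algebra: the derivative at `1` of `h ↦ g h g⁻¹`. -/
def Ad (g : G) (ξ : LieAlg EG G) : LieAlg EG G :=
  mfderiv 𝓘(ℝ, EG) 𝓘(ℝ, EG) (fun h : G => g * h * g⁻¹) 1 ξ

/-- `B` is an `Ad`-invariant inner product on the Lie algebra of `G`. -/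
structure IsAdInvariantInner (B : LieAlg EG G →L[ℝ] LieAlg EG G →L[ℝ] ℝ) : Prop where
  symm : ∀ ξ ζ, B ξ ζ = B ζ ξ
  pos : ∀ ξ, ξ ≠ 0 → 0 < B ξ ξ
  invariant : ∀ (g : G) (ξ ζ : LieAlg EG G), B (Ad g ξ) (Ad g ζ) = B ξ ζ

variable {EW HW : Type*} [NormedAddCommGroup EW] [NormedSpace ℝ EW] [TopologicalSpace HW]
  {W : Type*} [TopologicalSpace W] [ChartedSpace HW W]

/-- The vector field `ξ^W` of the infinitesimal action of `ξ`, for an action `a` of `G` on `W`: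
`ξ^W(w) = d/dt|₀ exp(-tξ) · w`, that is, minus the derivative at `1` of the orbit map `g ↦ g · w`
in the direction `ξ` (the velocity of `exp(-tξ)` at `t = 0` being `-ξ`). -/
def actionField (IW : ModelWithCorners ℝ EW HW) (a : G → W → W) (ξ : LieAlg EG G) (w : W) :
    TangentSpace IW w :=
  -(mfderiv 𝓘(ℝ, EG) IW (fun g : G => a g w) 1 ξ)

/-- The vector field `X^φ(w) = d/dt|₀ exp(-t φ(w)) · w` induced by a Lie algebra valued map. -/
def inducedField (IW : ModelWithCorners ℝ EW HW) (a : G → W → W) (φ : W → LieAlg EG G) (w : W) :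
    TangentSpace IW w :=
  actionField IW a (φ w) w

/-- `φ` is taming over the open invariant set `S`: the vanishing set of `X^φ` in `S` is compact.
Only the values of `φ` on `S` matter. -/
def IsTamingOn (IW : ModelWithCorners ℝ EW HW) (a : G → W → W) (φ : W → LieAlg EG G)
    (S : Set W) : Prop :=
  IsCompact {w | w ∈ S ∧ inducedField IW a φ w = 0}

/-- A set is invariant under the group action. -/
def IsInvariantSet (G : Type*) [Group G] {M : Type*} [MulAction G M] (S : Set M) : Prop :=
  ∀ (g : G), ∀ x ∈ S, g • x ∈ S

end Actions

/-! ### Hamiltonian spaces -/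

section Hamiltonian

variable {EG : Type*} [NormedAddCommGroup EG] [NormedSpace ℝ EG]
  {G : Type*} [TopologicalSpace G] [ChartedSpace EG G] [Group G]
  {EM : Type*} [NormedAddCommGroup EM] [NormedSpace ℝ EM]
  {M : Type*} [TopologicalSpace M] [ChartedSpace EM M] [IsManifold 𝓘(ℝ, EM) ∞ M] [MulAction G M]

/-- The tangent map of the action of `g` at `x`. -/
def tangentAct (EM : Type*) [NormedAddCommGroup EM] [NormedSpace ℝ EM]
    {M : Type*} [TopologicalSpace M] [ChartedSpace EM M] [MulAction G M] (g : G) (x : M) :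
    TangentSpace 𝓘(ℝ, EM) x →L[ℝ] TangentSpace 𝓘(ℝ, EM) (g • x) :=
  mfderiv 𝓘(ℝ, EM) 𝓘(ℝ, EM) (fun y : M => g • y) x

/-- A smooth vector field on `M`. -/
def IsSmoothField (X : Π x : M, TangentSpace 𝓘(ℝ, EM) x) : Prop :=
  ContMDiff 𝓘(ℝ, EM) (𝓘(ℝ, EM).prod 𝓘(ℝ, EM)) ∞
    (fun x => TotalSpace.mk' EM (E := fun x : M => TangentSpace 𝓘(ℝ, EM) x) x (X x))

/-- The directional derivative `X f` of a real function along a vector field. -/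
def dirDeriv (f : M → ℝ) (X : Π x : M, TangentSpace 𝓘(ℝ, EM) x) (x : M) : ℝ :=
  mfderiv 𝓘(ℝ, EM) 𝓘(ℝ, ℝ) f x (X x)

/-- A symplectic form: a smooth, alternating, nondegenerate, closed two-form. Closedness is
`dΩ = 0`, with `dΩ(X, Y, Z)` written by the invariant formula for the exterior derivative. -/
structure IsSymplecticForm
    (Ω : Π x : M, TangentSpace 𝓘(ℝ, EM) x →L[ℝ] TangentSpace 𝓘(ℝ, EM) x →L[ℝ] ℝ) : Prop where
  smooth : ContMDiff 𝓘(ℝ, EM) (𝓘(ℝ, EM).prod 𝓘(ℝ, EM →L[ℝ] EM →L[ℝ] ℝ)) ∞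
    (fun x => TotalSpace.mk' (EM →L[ℝ] EM →L[ℝ] ℝ)
      (E := fun x : M => TangentSpace 𝓘(ℝ, EM) x →L[ℝ] TangentSpace 𝓘(ℝ, EM) x →L[ℝ] ℝ) x (Ω x))
  alternating : ∀ x v, Ω x v v = 0
  nondegenerate : ∀ x v, (∀ w, Ω x v w = 0) → v = 0
  closed : ∀ X Y Z : Π x : M, TangentSpace 𝓘(ℝ, EM) x,
    IsSmoothField X → IsSmoothField Y → IsSmoothField Z → ∀ x,
      dirDeriv (fun y => Ω y (Y y) (Z y)) X x - dirDeriv (fun y => Ω y (X y) (Z y)) Y x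
        + dirDeriv (fun y => Ω y (X y) (Y y)) Z x
        - Ω x (VectorField.mlieBracket 𝓘(ℝ, EM) X Y x) (Z x)
        + Ω x (VectorField.mlieBracket 𝓘(ℝ, EM) X Z x) (Y x)
        - Ω x (VectorField.mlieBracket 𝓘(ℝ, EM) Y Z x) (X x) = 0

/-- `(M, Ω)` with the action of `G` is a Hamiltonian space with moment map `μ`. The moment map takes
values in the Lie algebra, identified with its dual by the inner product `B`; its component along
`ξ` is `μ_ξ = B μ ξ`. -/
structure IsHamiltonian (B : LieAlg EG G →L[ℝ] LieAlg EG G →L[ℝ] ℝ)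
    (Ω : Π x : M, TangentSpace 𝓘(ℝ, EM) x →L[ℝ] TangentSpace 𝓘(ℝ, EM) x →L[ℝ] ℝ)
    (μ : M → LieAlg EG G) : Prop where
  symplectic : IsSymplecticForm Ω
  invariant : ∀ (g : G) (x : M) (v w : TangentSpace 𝓘(ℝ, EM) x),
    Ω (g • x) (tangentAct EM g x v) (tangentAct EM g x w) = Ω x v w
  smooth : ContMDiff 𝓘(ℝ, EM) 𝓘(ℝ, EG) ∞ (M' := EG) μ
  equivariant : ∀ (g : G) (x : M), μ (g • x) = Ad g (μ x)
  /-- `dμ_ξ = Ω(ξ^M, ·)`. -/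
  hamilton : ∀ (ξ : LieAlg EG G) (x : M) (v : TangentSpace 𝓘(ℝ, EM) x),
    mfderiv 𝓘(ℝ, EM) 𝓘(ℝ, ℝ) (fun y => B (μ y) ξ) x v =
      Ω x (actionField 𝓘(ℝ, EM) (fun (g : G) (y : M) => g • y) ξ x) v

/-- `J` is a `G`-invariant smooth almost complex structure for which `Ω(X, JY)` is the
Riemannian metric `g`. -/
structure IsCompatible (G : Type*) [Group G] [MulAction G M]
    (Ω : Π x : M, TangentSpace 𝓘(ℝ, EM) x →L[ℝ] TangentSpace 𝓘(ℝ, EM) x →L[ℝ] ℝ)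
    (J : Π x : M, TangentSpace 𝓘(ℝ, EM) x →L[ℝ] TangentSpace 𝓘(ℝ, EM) x)
    (g : ContMDiffRiemannianMetric 𝓘(ℝ, EM) ∞ EM (fun x : M => TangentSpace 𝓘(ℝ, EM) x)) :
    Prop where
  smooth : ContMDiff 𝓘(ℝ, EM) (𝓘(ℝ, EM).prod 𝓘(ℝ, EM →L[ℝ] EM)) ∞
    (fun x => TotalSpace.mk' (EM →L[ℝ] EM)
      (E := fun x : M => TangentSpace 𝓘(ℝ, EM) x →L[ℝ] TangentSpace 𝓘(ℝ, EM) x) x (J x))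
  sq : ∀ x v, J x (J x v) = -v
  invariant : ∀ (h : G) (x : M) (v : TangentSpace 𝓘(ℝ, EM) x),
    J (h • x) (tangentAct EM h x v) = tangentAct EM h x (J x v)
  metric : ∀ (x : M) (v w : TangentSpace 𝓘(ℝ, EM) x), g.inner x v w = Ω x v (J x w)

end Hamiltonian

/-! ### Pre-quantum line bundles

A smooth Hermitian line bundle is a family `E` of one-dimensional complex inner product spaces with
local trivialisations in `ℂ` that are complex linear on the fibres and smooth in the base point. -/

section LineBundle

variable {EG : Type*} [NormedAddCommGroup EG] [NormedSpace ℝ EG]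
  {G : Type*} [TopologicalSpace G] [ChartedSpace EG G] [Group G]
  {EM : Type*} [NormedAddCommGroup EM] [NormedSpace ℝ EM]
  {M : Type*} [TopologicalSpace M] [ChartedSpace EM M] [IsManifold 𝓘(ℝ, EM) ∞ M] [MulAction G M]
  {E : M → Type*} [TopologicalSpace (TotalSpace ℂ E)]
  [∀ x, NormedAddCommGroup (E x)] [∀ x, InnerProductSpace ℂ (E x)]
  [FiberBundle ℂ E] [VectorBundle ℂ ℂ E] [VectorBundle ℝ ℂ E]
  [ContMDiffVectorBundle ∞ ℂ E 𝓘(ℝ, EM)]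

/-- A section is smooth on `S`. -/
def IsSmoothSectionOn (EM : Type*) [NormedAddCommGroup EM] [NormedSpace ℝ EM]
    {M : Type*} [TopologicalSpace M] [ChartedSpace EM M]
    {E : M → Type*} [TopologicalSpace (TotalSpace ℂ E)]
    [∀ x, NormedAddCommGroup (E x)] [∀ x, InnerProductSpace ℂ (E x)] [FiberBundle ℂ E]
    (s : Π x : M, E x) (S : Set M) : Prop :=
  ContMDiffOn 𝓘(ℝ, EM) (𝓘(ℝ, EM).prod 𝓘(ℝ, ℂ)) ∞ (fun x => TotalSpace.mk' ℂ x (s x)) S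

/-- A lift of the action of `G` on `M` to a smooth action on the Hermitian line bundle `E` by
complex linear isometries between the fibres. -/
structure BundleAction (EG : Type*) [NormedAddCommGroup EG] [NormedSpace ℝ EG]
    (G : Type*) [TopologicalSpace G] [ChartedSpace EG G] [Group G]
    (EM : Type*) [NormedAddCommGroup EM] [NormedSpace ℝ EM]
    {M : Type*} [TopologicalSpace M] [ChartedSpace EM M] [MulAction G M]
    (E : M → Type*) [TopologicalSpace (TotalSpace ℂ E)]
    [∀ x, NormedAddCommGroup (E x)] [∀ x, InnerProductSpace ℂ (E x)] [FiberBundle ℂ E] where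
  act : Π (g : G) (x : M), E x →ₗ[ℂ] E (g • x)
  one_act : ∀ (x : M) (v : E x),
    TotalSpace.mk' ℂ ((1 : G) • x) (act 1 x v) = TotalSpace.mk' ℂ x v
  mul_act : ∀ (g h : G) (x : M) (v : E x),
    TotalSpace.mk' ℂ ((g * h) • x) (act (g * h) x v) =
      TotalSpace.mk' ℂ (g • h • x) (act g (h • x) (act h x v))
  smooth : ContMDiff (𝓘(ℝ, EG).prod (𝓘(ℝ, EM).prod 𝓘(ℝ, ℂ))) (𝓘(ℝ, EM).prod 𝓘(ℝ, ℂ)) ∞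
    (fun p : G × TotalSpace ℂ E => TotalSpace.mk' ℂ (p.1 • p.2.1) (act p.1 p.2.1 p.2.2))
  isometry : ∀ (g : G) (x : M) (v w : E x), inner ℂ (act g x v) (act g x w) = inner ℂ v w

/-- The action of `g` on sections: `(g · s)(x) = g · s(g⁻¹ x)`. -/
def BundleAction.translate (ρ : BundleAction EG G EM E) (g : G) (s : Π x : M, E x) (x : M) : E x :=
  (smul_inv_smul g x) ▸ ρ.act g (g⁻¹ • x) (s (g⁻¹ • x))

/-- The Lie derivative of sections: `(𝓛_ξ s)(x) = d/dt|₀ exp(tξ) · s(exp(-tξ) x)`, that is, the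
derivative at `1` in the direction `ξ` of the map `g ↦ (g · s)(x)` from `G` to the fibre at `x`. -/
def BundleAction.lieDeriv (ρ : BundleAction EG G EM E) (ξ : LieAlg EG G) (s : Π x : M, E x)
    (x : M) : E x :=
  mfderiv 𝓘(ℝ, EG) 𝓘(ℝ, E x) (fun g : G => ρ.translate g s x) 1 ξ

/-- `E` with the lifted action `ρ` and the connection `nabla` is a pre-quantum line bundle
for `Ω`: the metric on the fibres is smooth, `nabla` is a smooth, `G`-invariant, Hermitian
connection on the complex line bundle, and `(√-1 / 2π) nabla² = Ω`. -/
structure IsPrequantum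
    (Ω : Π x : M, TangentSpace 𝓘(ℝ, EM) x →L[ℝ] TangentSpace 𝓘(ℝ, EM) x →L[ℝ] ℝ)
    (ρ : BundleAction EG G EM E) (nabla : CovariantDerivative 𝓘(ℝ, EM) ℂ E) : Prop where
  metric_smooth : ∀ s t : Π x : M, E x,
    IsSmoothSectionOn EM s univ → IsSmoothSectionOn EM t univ →
      ContMDiff 𝓘(ℝ, EM) 𝓘(ℝ, ℂ) ∞ (fun x => inner ℂ (s x) (t x))
  /-- `nabla_X s` is smooth for smooth `X` and `s`. -/
  smooth : ∀ (X : Π x : M, TangentSpace 𝓘(ℝ, EM) x) (s : Π x : M, E x),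
    IsSmoothField X → IsSmoothSectionOn EM s univ →
      IsSmoothSectionOn EM (fun x => nabla s x (X x)) univ
  complex_linear : ∀ (c : ℂ) (s : Π x : M, E x), IsSmoothSectionOn EM s univ →
    ∀ (x : M) (v : TangentSpace 𝓘(ℝ, EM) x), nabla (fun y => c • s y) x v = c • nabla s x v
  hermitian : ∀ s t : Π x : M, E x,
    IsSmoothSectionOn EM s univ → IsSmoothSectionOn EM t univ →
      ∀ (x : M) (v : TangentSpace 𝓘(ℝ, EM) x),
        mfderiv 𝓘(ℝ, EM) 𝓘(ℝ, ℂ) (fun y => inner ℂ (s y) (t y)) x v =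
          inner ℂ (nabla s x v) (t x) + inner ℂ (s x) (nabla t x v)
  invariant : ∀ (g : G) (s : Π x : M, E x), IsSmoothSectionOn EM s univ →
    ∀ (x : M) (v : TangentSpace 𝓘(ℝ, EM) x),
      nabla (ρ.translate g s) (g • x) (tangentAct EM g x v) = ρ.act g x (nabla s x v)
  curvature : ∀ (X Y : Π x : M, TangentSpace 𝓘(ℝ, EM) x) (s : Π x : M, E x),
    IsSmoothField X → IsSmoothField Y → IsSmoothSectionOn EM s univ → ∀ x : M,
      (Complex.I / (2 * Real.pi)) •
        (nabla (fun y => nabla s y (Y y)) x (X x) - nabla (fun y => nabla s y (X y)) x (Y x)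
          - nabla s x (VectorField.mlieBracket 𝓘(ℝ, EM) X Y x)) =
        ((Ω x (X x) (Y x) : ℝ) : ℂ) • s x

/-- `μ` is, on the open invariant set `S`, the moment map determined by the connection `nabla`
on `E` over `S` through the Kostant formula `2π√-1 μ_ξ = nabla_{ξ^M} - 𝓛_ξ`. -/
def IsKostantMomentOn (B : LieAlg EG G →L[ℝ] LieAlg EG G →L[ℝ] ℝ) (ρ : BundleAction EG G EM E)
    (nabla : (Π x : M, E x) → (Π x : M, TangentSpace 𝓘(ℝ, EM) x →L[ℝ] E x))
    (S : Set M) (μ : M → LieAlg EG G) : Prop :=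
  ∀ (ξ : LieAlg EG G) (s : Π x : M, E x), IsSmoothSectionOn EM s S → ∀ x ∈ S,
    (2 * Real.pi * Complex.I * ((B (μ x) ξ : ℝ) : ℂ)) • s x =
      nabla s x (actionField 𝓘(ℝ, EM) (fun (g : G) (y : M) => g • y) ξ x) - ρ.lieDeriv ξ s x

/-- The deformed connection `nabla + 2π√-1 χ (X^μ)^*`, where `(X^μ)^*` is the one-form dual to
`X^μ` for the Riemannian metric `g`. -/
def deformedConnection
    (g : ContMDiffRiemannianMetric 𝓘(ℝ, EM) ∞ EM (fun x : M => TangentSpace 𝓘(ℝ, EM) x))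
    (nabla : CovariantDerivative 𝓘(ℝ, EM) ℂ E) (μ : M → LieAlg EG G) (χ : M → ℝ)
    (s : Π x : M, E x) (x : M) : TangentSpace 𝓘(ℝ, EM) x →L[ℝ] E x :=
  nabla s x +
    (g.inner x (inducedField 𝓘(ℝ, EM) (fun (h : G) (y : M) => h • y) μ x)).smulRight
      ((2 * Real.pi * Complex.I * (χ x : ℂ)) • s x)

/-- The choice of `V` and `χ` over the open set `U`, where `μχ : U → 𝔤` is the moment map determined
by the connection deformed by `χ`. Only the values of `χ` and `μχ` on `U` matter. -/
structure IsProperDeformation (B : LieAlg EG G →L[ℝ] LieAlg EG G →L[ℝ] ℝ)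
    (g : ContMDiffRiemannianMetric 𝓘(ℝ, EM) ∞ EM (fun x : M => TangentSpace 𝓘(ℝ, EM) x))
    (ρ : BundleAction EG G EM E) (nabla : CovariantDerivative 𝓘(ℝ, EM) ℂ E)
    (μ : M → LieAlg EG G) (U V : Set M) (χ : M → ℝ) (μχ : M → LieAlg EG G) : Prop where
  invariant_V : IsInvariantSet G V
  nhds_V : {x | x ∈ U ∧ inducedField 𝓘(ℝ, EM) (fun (h : G) (y : M) => h • y) μ x = 0} ⊆ interior V
  compact_V : IsCompact (closure V)
  closure_V : closure V ⊆ U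
  smooth : ContMDiffOn 𝓘(ℝ, EM) 𝓘(ℝ, ℝ) ∞ χ U
  invariant : ∀ (h : G), ∀ x ∈ U, χ (h • x) = χ x
  moment : IsKostantMomentOn B ρ (deformedConnection g nabla μ χ) U μχ
  proper : IsProperMap (fun x : U => μχ x)
  eq_on_V : ∀ x ∈ V, μχ x = μ x
  norm_le : ∀ x ∈ U, √(B (μ x) (μ x)) ≤ √(B (μχ x) (μχ x))
  zeros : ∀ x ∈ U, (inducedField 𝓘(ℝ, EM) (fun (h : G) (y : M) => h • y) μχ x = 0 ↔
    inducedField 𝓘(ℝ, EM) (fun (h : G) (y : M) => h • y) μ x = 0)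

end LineBundle

/-! ### The cylinder `M × N × [0,1]` -/

section Cylinder

/-- The diagonal action on `M × N × [0,1]`, trivial on `[0,1]`. -/
def cylinderAct {G : Type*} [Group G] {M N : Type*} [MulAction G M] [MulAction G N] (g : G)
    (w : M × N × Icc (0 : ℝ) 1) : M × N × Icc (0 : ℝ) 1 :=
  (g • w.1, g • w.2.1, w.2.2)

/-- The map `φ(m, n, t) = μχ(m) + η(t) μF(n)`. -/
def cylinderMap {𝔤 : Type*} [AddCommGroup 𝔤] [Module ℝ 𝔤] {M N : Type*} (μχ : M → 𝔤) (μF : N → 𝔤)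
    (η : ℝ → ℝ) (w : M × N × Icc (0 : ℝ) 1) : 𝔤 :=
  μχ w.1 + η w.2.2 • μF w.2.1

/-- The model with corners of `M × N × [0,1]`. -/
abbrev cylinderModel (EM EN : Type*) [NormedAddCommGroup EM] [NormedSpace ℝ EM]
    [NormedAddCommGroup EN] [NormedSpace ℝ EN] :=
  𝓘(ℝ, EM).prod (𝓘(ℝ, EN).prod (𝓡∂ 1))

end Cylinder

end PreQuant

end

open PreQuant

/-! At a zero `(m, n, t)` of `X^φ` put `a = μχ(m)`, `b = η(t) μF(n)`, so that the generator is
`ξ = a + b`. Then `ξ^M(m) = 0`, hence the connection terms of both Kostant formulas drop out at `m`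
and `⟨a, a + b⟩ = ⟨μE(m), a + b⟩`. Since `a - μE(m)` is orthogonal to `a + b`, its length is at most
that of `b + μE(m)`, which is bounded. As `μχ` is proper, the zeroes lie in a compact subset of
`U × N × [0,1]`; being closed in it, they form a compact set. -/

namespace PreQuant

section PositiveForm

variable {W : Type*} [NormedAddCommGroup W] [NormedSpace ℝ W]

theorem isCoercive_of_pos [FiniteDimensional ℝ W] {B : W →L[ℝ] W →L[ℝ] ℝ}
    (hB : ∀ v, v ≠ 0 → 0 < B v v) : IsCoercive B := by
  have hcont : Continuous fun v => B v v := by fun_prop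
  obtain ⟨c, hc, hle⟩ := (isCompact_sphere (0 : W) 1).exists_forall_le' hcont.continuousOn
    fun v hv => hB v (ne_zero_of_mem_unit_sphere ⟨v, hv⟩)
  refine ⟨c, hc, fun v => ?_⟩
  rcases eq_or_ne v 0 with rfl | hv
  · simp
  have hn : ‖v‖ ≠ 0 := norm_ne_zero_iff.mpr hv
  have hunit : c ≤ B (‖v‖⁻¹ • v) (‖v‖⁻¹ • v) := hle _ (by simp [norm_smul, hn])
  calc c * ‖v‖ * ‖v‖ ≤ B (‖v‖⁻¹ • v) (‖v‖⁻¹ • v) * ‖v‖ * ‖v‖ := by gcongr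
    _ = B v v := by
      simp only [map_smul, _root_.smul_apply, smul_eq_mul]
      field_simp

theorem norm_sub_le_of_apply_add_eq {B : W →L[ℝ] W →L[ℝ] ℝ} {c : ℝ} (hc : 0 < c)
    (hcB : ∀ v, c * ‖v‖ * ‖v‖ ≤ B v v) {a b m : W} (h : B a (a + b) = B m (a + b)) :
    ‖a - m‖ ≤ ‖B‖ * ‖b + m‖ / c := by
  rcases (norm_nonneg (a - m)).eq_or_lt' with h₀ | h₀
  · rw [h₀]; positivity
  have horth : B (a - m) (a + b) = 0 := by rw [map_sub, _root_.sub_apply, h, sub_self]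
  have hself : B (a - m) (a - m) = -B (a - m) (b + m) := by
    rw [eq_neg_iff_add_eq_zero, ← map_add, ← horth]
    congr 1
    abel
  have hbound : c * ‖a - m‖ * ‖a - m‖ ≤ ‖B‖ * ‖b + m‖ * ‖a - m‖ :=
    calc c * ‖a - m‖ * ‖a - m‖ ≤ -B (a - m) (b + m) := hself ▸ hcB _
      _ ≤ ‖B (a - m) (b + m)‖ := neg_le_abs _
      _ ≤ ‖B‖ * ‖a - m‖ * ‖b + m‖ := B.le_opNorm₂ _ _
      _ = ‖B‖ * ‖b + m‖ * ‖a - m‖ := by ring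
  rw [le_div_iff₀' hc]
  exact le_of_mul_le_mul_right hbound h₀

theorem exists_isCompact_of_apply_add_eq [FiniteDimensional ℝ W] {B : W →L[ℝ] W →L[ℝ] ℝ}
    (hB : ∀ v, v ≠ 0 → 0 < B v v) {K L : Set W} (hK : IsCompact K) (hL : IsCompact L) :
    ∃ C, IsCompact C ∧ ∀ a, ∀ m ∈ K, ∀ b ∈ L, B a (a + b) = B m (a + b) → a ∈ C := by
  obtain ⟨c, hc, hcB⟩ := isCoercive_of_pos hB
  obtain ⟨D, hD⟩ := hK.isBounded.exists_norm_le
  obtain ⟨R, hR⟩ := hL.isBounded.exists_norm_le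
  refine ⟨Metric.closedBall 0 (‖B‖ * (R + D) / c + D), isCompact_closedBall _ _,
    fun a m hm b hb h => mem_closedBall_zero_iff.mpr ?_⟩
  calc ‖a‖ ≤ ‖a - m‖ + ‖m‖ := norm_le_norm_sub_add a m
    _ ≤ ‖B‖ * ‖b + m‖ / c + ‖m‖ := by gcongr; exact norm_sub_le_of_apply_add_eq hc hcB h
    _ ≤ ‖B‖ * (R + D) / c + D := by
      gcongr
      · exact norm_add_le_of_le (hR b hb) (hD m hm)
      · exact hD m hm

end PositiveForm

theorem isClosed_setOf_snd_eq_zero (R : Type*) {X F : Type*} [NontriviallyNormedField R]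
    [NormedAddCommGroup F] [NormedSpace R F] [TopologicalSpace X] {E : X → Type*}
    [TopologicalSpace (TotalSpace F E)] [∀ x, AddCommGroup (E x)] [∀ x, Module R (E x)]
    [∀ x, TopologicalSpace (E x)] [FiberBundle F E] [VectorBundle R F E] :
    IsClosed {v : TotalSpace F E | v.2 = 0} := by
  rw [← isOpen_compl_iff, isOpen_iff_eventually]
  intro v₀ hv₀
  let e := trivializationAt F E v₀.1
  have he : ∀ v ∈ e.source, (e v).2 = 0 ↔ v.2 = 0 := fun v hv =>
    (e.continuousLinearEquivAt R v.1 (e.mem_source.mp hv)).map_eq_zero_iff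
  have hmem : v₀ ∈ e.source := e.mem_source.mpr (FiberBundle.mem_baseSet_trivializationAt' v₀.1)
  have hcont : ContinuousAt (fun v => (e v).2) v₀ := (e.continuousAt hmem).snd
  filter_upwards [e.open_source.mem_nhds hmem,
    hcont.eventually_ne ((he v₀ hmem).not.mpr hv₀)] with v hv hne
  exact (he v hv).not.mp hne

section ActionField

variable {EG : Type*} [NormedAddCommGroup EG] [NormedSpace ℝ EG]
  {G : Type*} [TopologicalSpace G] [ChartedSpace EG G] [Group G]
  {EW HW : Type*} [NormedAddCommGroup EW] [NormedSpace ℝ EW] [TopologicalSpace HW]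
  {IW : ModelWithCorners ℝ EW HW} {W : Type*} [TopologicalSpace W] [ChartedSpace HW W]
  {EX HX : Type*} [NormedAddCommGroup EX] [NormedSpace ℝ EX] [TopologicalSpace HX]
  {IX : ModelWithCorners ℝ EX HX} {X : Type*} [TopologicalSpace X] [ChartedSpace HX X]
  {a : G → W → W} {b : G → X → X}

theorem mk_actionField_eq_tangentMap
    (ha : ContMDiff (𝓘(ℝ, EG).prod IW) IW 1 (Function.uncurry a)) (ha₁ : ∀ w, a 1 w = w)
    (ξ : LieAlg EG G) (w : W) :
    (⟨w, actionField IW a ξ w⟩ : TangentBundle IW W) =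
      tangentMap (𝓘(ℝ, EG).prod IW) IW (Function.uncurry a) ⟨(1, w), (-ξ, 0)⟩ := by
  refine TotalSpace.ext (ha₁ w).symm (heq_of_eq ?_)
  have hsum := mfderiv_prod_eq_add_apply
    (v := ((-ξ, 0) : TangentSpace (𝓘(ℝ, EG).prod IW) ((1 : G), w)))
    (ha.mdifferentiable one_ne_zero (1, w))
  have horbit : mfderiv 𝓘(ℝ, EG) IW (fun g => a g w) 1 (-ξ) = actionField IW a ξ w := map_neg _ _
  have hconst : mfderiv IW IW (fun y => a 1 y) w 0 = 0 := map_zero _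
  exact (hsum.trans ((congrArg₂ (· + ·) horbit hconst).trans (add_zero _))).symm

theorem continuous_actionField [IsManifold 𝓘(ℝ, EG) 1 G] [IsManifold IW 1 W]
    (ha : ContMDiff (𝓘(ℝ, EG).prod IW) IW 1 (Function.uncurry a)) (ha₁ : ∀ w, a 1 w = w) :
    Continuous fun p : LieAlg EG G × W =>
      (⟨p.2, actionField IW a p.1 p.2⟩ : TangentBundle IW W) := by
  simp_rw [mk_actionField_eq_tangentMap ha ha₁]
  have hdirection : Continuous fun p : LieAlg EG G × W =>
      (⟨1, -p.1⟩ : TangentBundle 𝓘(ℝ, EG) G) :=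
    (FiberBundle.continuous_totalSpaceMk EG (TangentSpace 𝓘(ℝ, EG)) (1 : G)).comp continuous_fst.neg
  have hzero : Continuous fun p : LieAlg EG G × W => (⟨p.2, 0⟩ : TangentBundle IW W) :=
    (Bundle.Trivialization.continuous_zeroSection ℝ).comp continuous_snd
  exact (ha.continuous_tangentMap le_rfl).comp <|
    (contMDiff_equivTangentBundleProd_symm (n := 0)).continuous.comp (hdirection.prodMk hzero)

theorem isClosed_setOf_actionField_eq_zero [IsManifold 𝓘(ℝ, EG) 1 G] [IsManifold IW 1 W]
    (ha : ContMDiff (𝓘(ℝ, EG).prod IW) IW 1 (Function.uncurry a)) (ha₁ : ∀ w, a 1 w = w) :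
    IsClosed {p : LieAlg EG G × W | actionField IW a p.1 p.2 = 0} :=
  (isClosed_setOf_snd_eq_zero ℝ).preimage (continuous_actionField ha ha₁)

theorem mfderiv_actionField {f : W → X} {w : W} (hf : MDifferentiableAt IW IX f w)
    (ha : MDifferentiableAt 𝓘(ℝ, EG) IW (fun g => a g w) 1) (ha₁ : a 1 w = w)
    (hab : ∀ g, f (a g w) = b g (f w)) (ξ : LieAlg EG G) :
    mfderiv IW IX f w (actionField IW a ξ w) = actionField IX b ξ (f w) := by
  have hcomp := mfderiv_comp_apply_of_eq (1 : G) hf ha ha₁ ξ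
  have hfun : f ∘ (fun g => a g w) = fun g => b g (f w) := funext hab
  rw [hfun] at hcomp
  exact (map_neg _ _).trans (congrArg Neg.neg hcomp.symm)

theorem isTamingOn_of_subset_isCompact [IsManifold 𝓘(ℝ, EG) 1 G] [IsManifold IW 1 W]
    (ha : ContMDiff (𝓘(ℝ, EG).prod IW) IW 1 (Function.uncurry a)) (ha₁ : ∀ w, a 1 w = w)
    {φ : W → LieAlg EG G} {S K : Set W} (hK : IsCompact K) (hKS : K ⊆ S) (hφ : ContinuousOn φ K)
    (hzeros : ∀ w ∈ S, inducedField IW a φ w = 0 → w ∈ K) : IsTamingOn IW a φ S := by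
  obtain ⟨Z, hZ, hZK⟩ := continuousOn_iff_isClosed.mp (hφ.prodMk continuousOn_id) _
    (isClosed_setOf_actionField_eq_zero ha ha₁)
  have hzeroSet : {w | w ∈ S ∧ inducedField IW a φ w = 0} = Z ∩ K := by
    rw [← hZK]
    exact Set.ext fun w => ⟨fun h => ⟨h.2, hzeros w h.1 h.2⟩, fun h => ⟨hKS h.2, h.1⟩⟩
  rw [IsTamingOn, hzeroSet]
  exact hK.inter_left hZ

end ActionField

section Cylinder

theorem cylinderAct_one (G : Type*) [Group G] {M N : Type*} [MulAction G M] [MulAction G N]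
    (w : M × N × Icc (0 : ℝ) 1) : cylinderAct (1 : G) w = w := by
  simp only [cylinderAct, one_smul]

variable {EG : Type*} [NormedAddCommGroup EG] [NormedSpace ℝ EG]
  {G : Type*} [TopologicalSpace G] [ChartedSpace EG G] [Group G]
  {EM : Type*} [NormedAddCommGroup EM] [NormedSpace ℝ EM]
  {M : Type*} [TopologicalSpace M] [ChartedSpace EM M] [MulAction G M]
  {EN : Type*} [NormedAddCommGroup EN] [NormedSpace ℝ EN]
  {N : Type*} [TopologicalSpace N] [ChartedSpace EN N] [MulAction G N]

theorem contMDiff_cylinderAct (n : ℕ∞ω) [ContMDiffSMul 𝓘(ℝ, EG) 𝓘(ℝ, EM) n G M]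
    [ContMDiffSMul 𝓘(ℝ, EG) 𝓘(ℝ, EN) n G N] :
    ContMDiff (𝓘(ℝ, EG).prod (cylinderModel EM EN)) (cylinderModel EM EN) n
      (Function.uncurry (cylinderAct (G := G) (M := M) (N := N))) :=
  (contMDiff_fst.smul contMDiff_snd.fst).prodMk
    ((contMDiff_fst.smul contMDiff_snd.snd.fst).prodMk contMDiff_snd.snd.snd)

theorem actionField_fst_eq_zero_of_cylinderAct [ContMDiffSMul 𝓘(ℝ, EG) 𝓘(ℝ, EM) 1 G M]
    [ContMDiffSMul 𝓘(ℝ, EG) 𝓘(ℝ, EN) 1 G N] {ξ : LieAlg EG G} {w : M × N × Icc (0 : ℝ) 1}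
    (h : actionField (cylinderModel EM EN) (cylinderAct (G := G)) ξ w = 0) :
    actionField 𝓘(ℝ, EM) (fun (g : G) (y : M) => g • y) ξ w.1 = 0 := by
  have horbit : MDifferentiable 𝓘(ℝ, EG) (cylinderModel EM EN) fun g : G => cylinderAct g w :=
    ((contMDiff_cylinderAct 1).comp (contMDiff_id.prodMk contMDiff_const)).mdifferentiable
      one_ne_zero
  have hfst := mfderiv_actionField (b := fun (g : G) (y : M) => g • y) mdifferentiableAt_fst
    (horbit 1) (cylinderAct_one G w) (fun _ => rfl) ξ
  rw [← hfst, h, map_zero]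

theorem continuousOn_cylinderMap {𝔤 : Type*} [TopologicalSpace 𝔤] [AddCommGroup 𝔤] [Module ℝ 𝔤]
    [ContinuousAdd 𝔤] [ContinuousSMul ℝ 𝔤] {μχ : M → 𝔤} {μF : N → 𝔤} {η : ℝ → ℝ} {U : Set M}
    (hμχ : ContinuousOn μχ U) (hμF : Continuous μF) (hη : ContinuousOn η (Icc 0 1)) :
    ContinuousOn (cylinderMap μχ μF η) (U ×ˢ univ) := by
  have hηt : Continuous fun w : M × N × Icc (0 : ℝ) 1 => η w.2.2 :=
    hη.domRestrict.comp continuous_snd.snd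
  exact (hμχ.comp continuousOn_fst fun _ hw => hw.1).add
    (hηt.smul (hμF.comp continuous_snd.fst)).continuousOn

end Cylinder

section Kostant

variable {EM : Type*} [NormedAddCommGroup EM] [NormedSpace ℝ EM] [FiniteDimensional ℝ EM]
  {M : Type*} [TopologicalSpace M] [ChartedSpace EM M] [IsManifold 𝓘(ℝ, EM) ∞ M] [T2Space M]

theorem exists_contMDiff_section_eq (F : Type*) [NormedAddCommGroup F] [NormedSpace ℝ F]
    {E : M → Type*} [TopologicalSpace (TotalSpace F E)] [∀ x, AddCommGroup (E x)]
    [∀ x, Module ℝ (E x)] [∀ x, TopologicalSpace (E x)] [FiberBundle F E] [VectorBundle ℝ F E]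
    [ContMDiffVectorBundle ∞ F E 𝓘(ℝ, EM)] {x : M} (v : E x) :
    ∃ s : Π y : M, E y, ContMDiff 𝓘(ℝ, EM) (𝓘(ℝ, EM).prod 𝓘(ℝ, F)) ∞
      (fun y => TotalSpace.mk' F y (s y)) ∧ s x = v := by
  obtain ⟨t, ht, hs⟩ := FiberBundle.exists_contMDiffOn_extend (k := ∞) 𝓘(ℝ, EM) F v
  obtain ⟨f, -, hf⟩ := (SmoothBumpFunction.nhds_basis_tsupport (I := 𝓘(ℝ, EM)) x).mem_iff.mp
    (interior_mem_nhds.mpr ht)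
  exact ⟨(f : M → ℝ) • FiberBundle.extend F v,
    f.contMDiff.contMDiffOn.smul_section_of_tsupport isOpen_interior hf
      (hs.mono interior_subset), by simp⟩

theorem IsKostantMomentOn.apply_eq_of_actionField_eq_zero
    {EG : Type*} [NormedAddCommGroup EG] [NormedSpace ℝ EG]
    {G : Type*} [TopologicalSpace G] [ChartedSpace EG G] [Group G] [MulAction G M]
    {E : M → Type*} [TopologicalSpace (TotalSpace ℂ E)]
    [∀ x, NormedAddCommGroup (E x)] [∀ x, InnerProductSpace ℂ (E x)]
    [FiberBundle ℂ E] [VectorBundle ℝ ℂ E] [ContMDiffVectorBundle ∞ ℂ E 𝓘(ℝ, EM)]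
    {B : LieAlg EG G →L[ℝ] LieAlg EG G →L[ℝ] ℝ} {ρ : BundleAction EG G EM E}
    {nabla₁ nabla₂ : (Π x : M, E x) → (Π x : M, TangentSpace 𝓘(ℝ, EM) x →L[ℝ] E x)}
    {S₁ S₂ : Set M} {μ₁ μ₂ : M → LieAlg EG G}
    (h₁ : IsKostantMomentOn B ρ nabla₁ S₁ μ₁) (h₂ : IsKostantMomentOn B ρ nabla₂ S₂ μ₂)
    {x : M} (hx₁ : x ∈ S₁) (hx₂ : x ∈ S₂) {ξ : LieAlg EG G}
    (hξ : actionField 𝓘(ℝ, EM) (fun (g : G) (y : M) => g • y) ξ x = 0) :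
    B (μ₁ x) ξ = B (μ₂ x) ξ := by
  let e := (trivializationAt ℂ E x).continuousLinearEquivAt ℝ x
    (FiberBundle.mem_baseSet_trivializationAt' x)
  obtain ⟨s, hs, hsx⟩ := exists_contMDiff_section_eq (EM := EM) ℂ (e.symm 1)
  have hs₀ : s x ≠ 0 := by simp [hsx]
  have hlie : (2 * Real.pi * Complex.I * ((B (μ₁ x) ξ : ℝ) : ℂ)) • s x =
      (2 * Real.pi * Complex.I * ((B (μ₂ x) ξ : ℝ) : ℂ)) • s x := by
    rw [h₁ ξ s hs.contMDiffOn x hx₁, h₂ ξ s hs.contMDiffOn x hx₂, hξ, map_zero, map_zero]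
  exact Complex.ofReal_injective
    (mul_left_cancel₀ Complex.two_pi_I_ne_zero (smul_left_injective ℂ hs₀ hlie))

end Kostant

end PreQuant

theorem lemma5p1_general
    {EG : Type*} [NormedAddCommGroup EG] [NormedSpace ℝ EG] [FiniteDimensional ℝ EG]
    {G : Type*} [TopologicalSpace G] [ChartedSpace EG G] [Group G] [IsManifold 𝓘(ℝ, EG) 1 G]
    {B : LieAlg EG G →L[ℝ] LieAlg EG G →L[ℝ] ℝ} (hB : ∀ ξ, ξ ≠ 0 → 0 < B ξ ξ)
    {EM : Type*} [NormedAddCommGroup EM] [NormedSpace ℝ EM]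
    {M : Type*} [TopologicalSpace M] [ChartedSpace EM M] [IsManifold 𝓘(ℝ, EM) 1 M]
    [MulAction G M] [ContMDiffSMul 𝓘(ℝ, EG) 𝓘(ℝ, EM) 1 G M]
    {EN : Type*} [NormedAddCommGroup EN] [NormedSpace ℝ EN]
    {N : Type*} [TopologicalSpace N] [ChartedSpace EN N] [IsManifold 𝓘(ℝ, EN) 1 N]
    [CompactSpace N] [MulAction G N] [ContMDiffSMul 𝓘(ℝ, EG) 𝓘(ℝ, EN) 1 G N]
    {U : Set M} (hU : IsCompact (closure U))
    {μ μχ : M → LieAlg EG G} (hμ : ContinuousOn μ (closure U))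
    (hμχ : IsProperMap (fun x : U => μχ x))
    (hpair : ∀ x ∈ U, ∀ ξ, actionField 𝓘(ℝ, EM) (fun (g : G) (y : M) => g • y) ξ x = 0 →
      B (μχ x) ξ = B (μ x) ξ)
    {μF : N → LieAlg EG G} (hμF : Continuous μF) {η : ℝ → ℝ} (hη : ContinuousOn η (Icc 0 1)) :
    IsTamingOn (cylinderModel EM EN) (cylinderAct (G := G) (M := M) (N := N))
      (cylinderMap μχ μF η) (U ×ˢ univ) := by
  have hL : IsCompact (range fun p : Icc (0 : ℝ) 1 × N => η p.1 • μF p.2) :=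
    isCompact_range ((hη.domRestrict.comp continuous_fst).smul (hμF.comp continuous_snd))
  obtain ⟨C, hC, hmem⟩ := exists_isCompact_of_apply_add_eq (W := EG) hB
    (hU.image_of_continuousOn hμ) hL
  let K : Set M := (↑) '' ((fun x : U => μχ x) ⁻¹' C)
  have hK : IsCompact K := (hμχ.isCompact_preimage hC).image continuous_subtype_val
  have hKU : K ⊆ U := Subtype.coe_image_subset _ _
  have hcont : ContinuousOn μχ K :=
    (continuousOn_iff_continuous_domRestrict.mpr hμχ.continuous).mono hKU
  refine isTamingOn_of_subset_isCompact (contMDiff_cylinderAct 1) (cylinderAct_one G)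
    (hK.prod isCompact_univ) (prod_mono_left hKU) (continuousOn_cylinderMap hcont hμF hη) ?_
  rintro ⟨x, n, t⟩ ⟨hx, -⟩ hzero
  have hpairing := hpair x hx _ (actionField_fst_eq_zero_of_cylinderAct hzero)
  have hxC : μχ x ∈ C :=
    hmem _ _ (mem_image_of_mem μ (subset_closure hx)) _ (mem_range_self (t, n)) hpairing
  exact ⟨⟨⟨x, hx⟩, hxC, rfl⟩, mem_univ _⟩

theorem lemma5p1
    -- `G` is a compact, connected Lie group with an `Ad`-invariant inner product on its Lie algebra
    {EG : Type*} [NormedAddCommGroup EG] [NormedSpace ℝ EG] [FiniteDimensional ℝ EG]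
    {G : Type*} [TopologicalSpace G] [ChartedSpace EG G] [Group G] [LieGroup 𝓘(ℝ, EG) ∞ G]
    [T2Space G] [CompactSpace G] [ConnectedSpace G]
    (B : LieAlg EG G →L[ℝ] LieAlg EG G →L[ℝ] ℝ) (hB : IsAdInvariantInner B)
    -- `M` is a Hamiltonian `G`-space with pre-quantum line bundle `E`
    {EM : Type*} [NormedAddCommGroup EM] [NormedSpace ℝ EM] [FiniteDimensional ℝ EM]
    {M : Type*} [TopologicalSpace M] [ChartedSpace EM M] [IsManifold 𝓘(ℝ, EM) ∞ M]
    [T2Space M] [SecondCountableTopology M]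
    [MulAction G M] [ContMDiffSMul 𝓘(ℝ, EG) 𝓘(ℝ, EM) ∞ G M]
    (ωM : Π x : M, TangentSpace 𝓘(ℝ, EM) x →L[ℝ] TangentSpace 𝓘(ℝ, EM) x →L[ℝ] ℝ)
    (μE : M → LieAlg EG G) (hM : IsHamiltonian B ωM μE)
    (J : Π x : M, TangentSpace 𝓘(ℝ, EM) x →L[ℝ] TangentSpace 𝓘(ℝ, EM) x)
    (gM : ContMDiffRiemannianMetric 𝓘(ℝ, EM) ∞ EM (fun x : M => TangentSpace 𝓘(ℝ, EM) x))
    (hJ : IsCompatible G ωM J gM)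
    {E : M → Type*} [TopologicalSpace (TotalSpace ℂ E)]
    [∀ x, NormedAddCommGroup (E x)] [∀ x, InnerProductSpace ℂ (E x)]
    [FiberBundle ℂ E] [VectorBundle ℂ ℂ E] [VectorBundle ℝ ℂ E]
    [ContMDiffVectorBundle ∞ ℂ E 𝓘(ℝ, EM)]
    (ρE : BundleAction EG G EM E) (nablaE : CovariantDerivative 𝓘(ℝ, EM) ℂ E)
    (hE : IsPrequantum ωM ρE nablaE) (hμE : IsKostantMomentOn B ρE nablaE univ μE)
    -- `N` is a compact Hamiltonian `G`-space with pre-quantum line bundle `F`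
    {EN : Type*} [NormedAddCommGroup EN] [NormedSpace ℝ EN] [FiniteDimensional ℝ EN]
    {N : Type*} [TopologicalSpace N] [ChartedSpace EN N] [IsManifold 𝓘(ℝ, EN) ∞ N]
    [T2Space N] [CompactSpace N]
    [MulAction G N] [ContMDiffSMul 𝓘(ℝ, EG) 𝓘(ℝ, EN) ∞ G N]
    (ωN : Π x : N, TangentSpace 𝓘(ℝ, EN) x →L[ℝ] TangentSpace 𝓘(ℝ, EN) x →L[ℝ] ℝ)
    (μF : N → LieAlg EG G) (hN : IsHamiltonian B ωN μF)
    {F : N → Type*} [TopologicalSpace (TotalSpace ℂ F)]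
    [∀ x, NormedAddCommGroup (F x)] [∀ x, InnerProductSpace ℂ (F x)]
    [FiberBundle ℂ F] [VectorBundle ℂ ℂ F] [VectorBundle ℝ ℂ F]
    [ContMDiffVectorBundle ∞ ℂ F 𝓘(ℝ, EN)]
    (ρF : BundleAction EG G EN F) (nablaF : CovariantDerivative 𝓘(ℝ, EN) ℂ F)
    (hF : IsPrequantum ωN ρF nablaF) (hμF : IsKostantMomentOn B ρF nablaF univ μF)
    -- `U` is an invariant, open, relatively compact subset of `M` over which `μE` is taming
    (U : Set M) (hUo : IsOpen U) (hUi : IsInvariantSet G U) (hUc : IsCompact (closure U))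
    (hUt : IsTamingOn 𝓘(ℝ, EM) (fun (g : G) (x : M) => g • x) μE U)
    -- the choice of `V`, of `χ`, and the resulting proper moment map `μχ` on `U`
    (V : Set M) (χ : M → ℝ) (μχ : M → LieAlg EG G)
    (hχ : IsProperDeformation B gM ρE nablaE μE U V χ μχ)
    -- the cutoff function `η`
    (η : ℝ → ℝ) (hη : ContDiff ℝ ∞ η) (hη01 : ∀ t, η t ∈ Icc (0 : ℝ) 1)
    (hη0 : ∀ t, t ≤ 1 / 3 → η t = 0) (hη1 : ∀ t, 2 / 3 ≤ t → η t = 1) :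
    IsTamingOn (cylinderModel EM EN) (cylinderAct (G := G) (M := M) (N := N))
      (cylinderMap μχ μF η) (U ×ˢ univ) :=
  lemma5p1_general hB.pos hUc hM.smooth.continuous.continuousOn hχ.proper
    (fun _ hx _ hξ => hχ.moment.apply_eq_of_actionField_eq_zero hμE hx (mem_univ _) hξ)
    hN.smooth.continuous hη.continuous.continuousOn
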